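/- Identify subsets of $\omega$ with elements of $2^\omega$. Let $\langle\cdot,\cdot\rangle$ be a fixed computable pairing bijection $\omega^2\to\omega$, and for $X\subseteq\omega$, $n\in\omega$ and $A\subseteq\omega$ put $X^{[n]}=\{k:\langle n,k\rangle\in X\}$ and $X^{[A]}=\{\langle m,k\rangle\in X: m\in A\}$. Let $(\Phi_e)_{e\in\omega}$ be a standard enumeration of the Turing functionals, and let $X'=\{e:\Phi_e^X(e)\downarrow\}$ be the Turing jump. Let $(\omega,\prec)$ be a computable presentation of an ordinal $\alpha$, i.e. $\prec$ is a computable (strict) well-order of $\omega$ of order type $\alpha$. A set $H\subseteq\omega$ is a jump hierarchy supported on $\prec$ if $H^{[n]}=\bigl(H^{[\{m\,:\,m\prec n\}]}\bigr)'$ for all $n\in\omega$. Define an equivalence relation $\equiv_\prec$ on $2^\omega$ by $$x\equiv_\prec y\iff x=y\ \text{ or }\ \bigl(x^{[1]}=y^{[1]}\text{ and } x^{[1]}\text{ is a jump hierarchy supported on }\prec\bigr).$$ A learner for an equivalence relation $E$ on a topological space $X$ is a sequence of continuous functions $l_n:X^\omega\times X\to\omega$ ($\omega$ discrete) such that for all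 $\vec x=(x_i)_{i\in\omega}\in X^\omega$ and $x\in X$, if $x\mathrel{E}x_i$ for some $i$, then $L=\lim_n l_n(\vec x,x)$ exists and $x\mathrel{E}x_L$. The relation $E$ is uniformly learnable if it has a learner. For $X=2^\omega$ and $z\in 2^\omega$, $E$ is $z$-learnable if it has a learner $(l_n)$ for which there is a $z$-recursive $f:\omega\to\omega$ with $\Phi_{f(n)}^{z}=l_n$ for all $n$, that is, $\Phi_{f(n)}^{z\oplus(\bigoplus_i x_i\oplus x)}(0)=l_n(\vec x,x)$ for all $\vec x$, $x$ and $n$. Then: (1) $\equiv_\prec$ is uniformly learnable; (2) there is exactly one jump hierarchy supported on $\prec$, denoted $\emptyset^{(\alpha)}$; (3) for every $z\in2^\omega$, if $\equiv_\prec$ is $z$-learnable, then $z\geq_T\emptyset^{(\alpha)}$. -/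

import Mathlib

open Filter Topology

/-- Cantor space `2^ω` with the product topology; a subset of `ω` is identified with its
characteristic function. -/
abbrev Cantor : Type := ℕ → Bool

namespace Cantor

/-- A real as a total function `ω → {0, 1}`, in the form used for oracles. -/
def toPFun (X : Cantor) : ℕ →. ℕ := fun n => Part.some (X n).toNat

/-- The initial segment `X ↾ k`. -/
def initSeg (X : Cantor) (k : ℕ) : List Bool := (List.range k).map X

/-- The join `X ⊕ Y`. -/
def join (X Y : Cantor) : Cantor := fun n => if n % 2 = 0 then X (n / 2) else Y (n / 2)

/-- The join `⨁ i, X i = {⟨i, k⟩ : k ∈ X i}` of a sequence of reals. -/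
def seqJoin (X : ℕ → Cantor) : Cantor := fun n => X n.unpair.1 n.unpair.2

/-- The column `X^[n] = {k : ⟨n, k⟩ ∈ X}`. -/
def column (X : Cantor) (n : ℕ) : Cantor := fun k => X (Nat.pair n k)

open Classical in
/-- The part of `X` in the columns with index in `A`: `X^[A] = {⟨m, k⟩ ∈ X : m ∈ A}`. -/
noncomputable def columns (X : Cantor) (A : Set ℕ) : Cantor :=
  fun p => decide (p.unpair.1 ∈ A) && X p

end Cantor

/-- The standard enumeration `(Φ_e)` of the Turing functionals, in Kleene normal form:
`Φ_e^X(n)` is the output of the `e`-th program on input `(X ↾ k, n)`, for the first `s = ⟨k, t⟩`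
such that the program halts on that input within `t` steps. It diverges if there is no such `s`. -/
def turingFunctional (e : ℕ) (X : Cantor) : ℕ →. ℕ := fun n =>
  Nat.rfindOpt fun s =>
    Nat.Partrec.Code.evaln s.unpair.2 (Denumerable.ofNat Nat.Partrec.Code e)
      (Nat.pair (Encodable.encode (X.initSeg s.unpair.1)) n)

namespace TuringFunctional

theorem mem_rf {g : ℕ →. ℕ} {v : ℕ} :
    v ∈ Nat.rfind (fun m => (g m).map fun m => decide (m = 0)) ↔
      (∃ a ∈ g v, decide (a = 0) = true) ∧
        ∀ {m}, m < v → ∃ a ∈ g m, decide (a = 0) = false :=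
  Nat.mem_rfind.trans (and_congr (Part.mem_map_iff _) (forall_congr' fun _ =>
    imp_congr_right fun _ => Part.mem_map_iff _))

theorem partrec_prec {F G : List Bool → ℕ →. ℕ} (pF : Partrec₂ F) (pG : Partrec₂ G) :
    Partrec₂ fun (s : List Bool) (n : ℕ) => (n.unpair.2.rec (F s n.unpair.1) fun y IH =>
      IH.bind fun i => G s (Nat.pair n.unpair.1 (Nat.pair y i)) : Part ℕ) := by
  have h1 : Partrec fun p : List Bool × ℕ => F p.1 p.2.unpair.1 :=
    pF.comp Computable.fst (Computable.fst.comp (Computable.unpair.comp Computable.snd))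
  have h2 : Partrec₂ fun (p : List Bool × ℕ) (q : ℕ × ℕ) =>
      G p.1 (Nat.pair p.2.unpair.1 (Nat.pair q.1 q.2)) := by
    have h3 : Computable fun x : (List Bool × ℕ) × (ℕ × ℕ) =>
        Nat.pair x.1.2.unpair.1 (Nat.pair x.2.1 x.2.2) :=
      Primrec₂.natPair.to_comp.comp
        (Computable.fst.comp (Computable.unpair.comp (Computable.snd.comp Computable.fst)))
        (Primrec₂.natPair.to_comp.comp (Computable.fst.comp Computable.snd)
          (Computable.snd.comp Computable.snd))
    exact (pG.comp (Computable.fst.comp Computable.fst) h3)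
  exact Partrec.nat_rec (Computable.snd.comp (Computable.unpair.comp Computable.snd)) h1 h2

theorem partrec_rfind {F : List Bool → ℕ →. ℕ} (pF : Partrec₂ F) :
    Partrec₂ fun (s : List Bool) (a : ℕ) =>
      Nat.rfind fun n => (F s (Nat.pair a n)).map fun m => decide (m = 0) := by
  have h1 : Partrec fun q : (List Bool × ℕ) × ℕ => F q.1.1 (Nat.pair q.1.2 q.2) :=
    pF.comp (Computable.fst.comp Computable.fst)
      (Primrec₂.natPair.to_comp.comp (Computable.snd.comp Computable.fst) Computable.snd)
  have h2 : Computable fun m : ℕ => decide (m = 0) :=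
    (Primrec.eq.decide.comp Primrec.id (Primrec.const 0)).to_comp
  exact Partrec.rfind (Partrec.map h1 (h2.comp Computable.snd).to₂).to₂

open Nat.Partrec in
theorem exists_approx {X : Cantor} {f : ℕ →. ℕ} (hf : Nat.RecursiveIn {X.toPFun} f) :
    ∃ F : List Bool → ℕ →. ℕ, Partrec₂ F ∧
      (∀ s t n v, s <+: t → v ∈ F s n → v ∈ F t n) ∧
      ∀ n v, v ∈ f n ↔ ∃ k, v ∈ F (X.initSeg k) n := by
  have mono : ∀ {j k}, j ≤ k → X.initSeg j <+: X.initSeg k := by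
    intro j k h
    obtain ⟨d, rfl⟩ := Nat.exists_eq_add_of_le h
    simp [Cantor.initSeg, List.range_add]
  have base : ∀ g : ℕ →. ℕ, Partrec g → ∃ F : List Bool → ℕ →. ℕ, Partrec₂ F ∧
      (∀ s t n v, s <+: t → v ∈ F s n → v ∈ F t n) ∧
      ∀ n v, v ∈ g n ↔ ∃ k, v ∈ F (X.initSeg k) n := fun g hg =>
    ⟨fun _ => g, hg.comp Computable.snd, by simp, by simp⟩
  induction hf with
  | zero => exact base _ (Partrec.nat_iff.2 Nat.Partrec.zero)
  | succ => exact base _ (Partrec.nat_iff.2 Nat.Partrec.succ)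
  | left => exact base _ (Partrec.nat_iff.2 Nat.Partrec.left)
  | right => exact base _ (Partrec.nat_iff.2 Nat.Partrec.right)
  | oracle g hg =>
    rw [Set.mem_singleton_iff] at hg
    subst hg
    refine ⟨fun s n => ((s[n]?).map Bool.toNat : Option ℕ), ?_, ?_, ?_⟩
    · exact Computable.ofOption ((Primrec.option_map (Primrec.list_getElem?.comp Primrec.fst Primrec.snd)
        ((Primrec.dom_bool Bool.toNat).comp Primrec.snd).to₂).to_comp)
    · rintro s t n v ⟨u, rfl⟩ h
      simp only [Part.mem_coe, Option.mem_def, Option.map_eq_some_iff] at h ⊢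
      obtain ⟨b, hb, rfl⟩ := h
      exact ⟨b, by rw [List.getElem?_append_left (List.getElem?_eq_some_iff.1 hb).1]; exact hb, rfl⟩
    · intro n v
      simp only [Cantor.toPFun, Cantor.initSeg, Part.mem_some_iff, Part.mem_coe, Option.mem_def,
        Option.map_eq_some_iff, List.getElem?_map]
      constructor
      · rintro rfl
        exact ⟨n + 1, X n, ⟨n, by simp, rfl⟩, rfl⟩
      · rintro ⟨k, b, ⟨m, hm, rfl⟩, rfl⟩
        obtain ⟨h1, h2⟩ := List.getElem?_eq_some_iff.1 hm
        simp at h2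
        rw [h2]
  | @pair f h _ _ ihf ihh =>
    obtain ⟨F, pF, mF, eF⟩ := ihf
    obtain ⟨G, pG, mG, eG⟩ := ihh
    refine ⟨fun s n => (F s n).bind fun a => (G s n).map fun b => Nat.pair a b, ?_, ?_, ?_⟩
    · exact Partrec.bind pF (Partrec.map (pG.comp (Computable.fst.comp Computable.fst)
        (Computable.snd.comp Computable.fst))
        (Primrec₂.natPair.to_comp.comp (Computable.snd.comp Computable.fst) Computable.snd).to₂).to₂
    · intro s t n v hst hv
      simp only [Part.mem_bind_iff, Part.mem_map_iff] at hv ⊢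
      obtain ⟨a, ha, b, hb, rfl⟩ := hv
      exact ⟨a, mF _ _ _ _ hst ha, b, mG _ _ _ _ hst hb, rfl⟩
    · intro n v
      simp only [Seq.seq, Part.map_eq_map, Part.mem_bind_iff, Part.mem_map_iff]
      constructor
      · rintro ⟨_, ⟨a, ha, rfl⟩, b, hb, rfl⟩
        obtain ⟨k, hk⟩ := (eF _ _).1 ha
        obtain ⟨j, hj⟩ := (eG _ _).1 hb
        exact ⟨max k j, a, mF _ _ _ _ (mono (le_max_left _ _)) hk,
          b, mG _ _ _ _ (mono (le_max_right _ _)) hj, rfl⟩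
      · rintro ⟨k, a, ha, b, hb, rfl⟩
        exact ⟨_, ⟨a, (eF _ _).2 ⟨k, ha⟩, rfl⟩, b, (eG _ _).2 ⟨k, hb⟩, rfl⟩
  | @comp f h _ _ ihf ihh =>
    obtain ⟨F, pF, mF, eF⟩ := ihf
    obtain ⟨G, pG, mG, eG⟩ := ihh
    refine ⟨fun s n => (G s n).bind fun a => F s a, ?_, ?_, ?_⟩
    · exact Partrec.bind pG (pF.comp (Computable.fst.comp Computable.fst) Computable.snd).to₂
    · intro s t n v hst hv
      simp only [Part.mem_bind_iff] at hv ⊢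
      obtain ⟨a, ha, hb⟩ := hv
      exact ⟨a, mG _ _ _ _ hst ha, mF _ _ _ _ hst hb⟩
    · intro n v
      change v ∈ (h n).bind (fun a => f a) ↔ ∃ k, v ∈ (G _ n).bind fun a => F _ a
      simp only [Part.mem_bind_iff]
      constructor
      · rintro ⟨a, ha, hb⟩
        obtain ⟨k, hk⟩ := (eG _ _).1 ha
        obtain ⟨j, hj⟩ := (eF _ _).1 hb
        exact ⟨max k j, a, mG _ _ _ _ (mono (le_max_left _ _)) hk,
          mF _ _ _ _ (mono (le_max_right _ _)) hj⟩
      · rintro ⟨k, a, ha, hb⟩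
        exact ⟨a, (eG _ _).2 ⟨k, ha⟩, (eF _ _).2 ⟨k, hb⟩⟩
  | @prec f h _ _ ihf ihh =>
    obtain ⟨F, pF, mF, eF⟩ := ihf
    obtain ⟨G, pG, mG, eG⟩ := ihh
    let R : List Bool → ℕ → ℕ →. ℕ := fun s a n =>
      n.rec (F s a) fun y IH => IH.bind fun i => G s (Nat.pair a (Nat.pair y i))
    have mR : ∀ s t a n v, s <+: t → v ∈ R s a n → v ∈ R t a n := by
      intro s t a n v hst
      induction n generalizing v with
      | zero => exact mF _ _ _ _ hst
      | succ n ih =>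
        simp only [R, Part.mem_bind_iff]
        rintro ⟨i, hi, hv⟩
        exact ⟨i, ih _ hi, mG _ _ _ _ hst hv⟩
    refine ⟨fun s n => R s n.unpair.1 n.unpair.2, ?_, ?_, ?_⟩
    · exact partrec_prec pF pG
    · exact fun s t n v => mR _ _ _ _ _
    · intro n v
      simp only []
      generalize n.unpair.1 = a
      generalize n.unpair.2 = m
      induction m generalizing v with
      | zero => exact eF _ _
      | succ m ih =>
        simp only [R, Part.bind_eq_bind, Part.mem_bind_iff] at ih ⊢
        constructor
        · rintro ⟨i, hi, hv⟩
          obtain ⟨k, hk⟩ := (ih _).1 hi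
          obtain ⟨j, hj⟩ := (eG _ _).1 hv
          exact ⟨max k j, i, mR _ _ _ _ _ (mono (le_max_left _ _)) hk,
            mG _ _ _ _ (mono (le_max_right _ _)) hj⟩
        · rintro ⟨k, i, hi, hv⟩
          exact ⟨i, (ih _).2 ⟨k, hi⟩, (eG _ _).2 ⟨k, hv⟩⟩
  | @rfind f _ ihf =>
    obtain ⟨F, pF, mF, eF⟩ := ihf
    refine ⟨fun s a => Nat.rfind fun n => (F s (Nat.pair a n)).map fun m => decide (m = 0),
      ?_, ?_, ?_⟩
    · exact partrec_rfind pF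
    · intro s t n v hst hv
      simp only [] at hv ⊢
      rw [mem_rf (g := fun m => F _ (Nat.pair n m))] at hv ⊢
      refine ⟨?_, fun {m} hm => ?_⟩
      · obtain ⟨a, ha, h⟩ := hv.1
        exact ⟨a, mF _ _ _ _ hst ha, h⟩
      · obtain ⟨a, ha, h⟩ := hv.2 hm
        exact ⟨a, mF _ _ _ _ hst ha, h⟩
    · intro n v
      change v ∈ Nat.rfind (fun m => (f (Nat.pair n m)).map fun m => decide (m = 0)) ↔ _
      rw [mem_rf (g := fun m => f (Nat.pair n m))]
      simp only [mem_rf (g := fun m => F _ (Nat.pair n m))]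
      constructor
      · rintro ⟨⟨a, ha, h⟩, h2⟩
        obtain ⟨k, hk⟩ := (eF _ _).1 ha
        have : ∀ m, ∃ j, m < v → ∃ a, a ∈ F (X.initSeg j) (Nat.pair n m) ∧ decide (a = 0) = false := by
          intro m
          by_cases hm : m < v
          · obtain ⟨b, hb, h⟩ := h2 hm
            obtain ⟨j, hj⟩ := (eF _ _).1 hb
            exact ⟨j, fun _ => ⟨b, hj, h⟩⟩
          · exact ⟨0, fun h => absurd h hm⟩
        choose j hj using this
        refine ⟨max k ((Finset.range v).sup j), ⟨a, mF _ _ _ _ (mono (le_max_left _ _)) hk, h⟩, ?_⟩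
        intro m hm
        obtain ⟨b, hb, h⟩ := hj m hm
        exact ⟨b, mF _ _ _ _ (mono (le_trans (Finset.le_sup (Finset.mem_range.2 hm))
          (le_max_right _ _))) hb, h⟩
      · rintro ⟨k, ⟨a, ha, h⟩, h2⟩
        refine ⟨⟨a, (eF _ _).2 ⟨k, ha⟩, h⟩, fun {m} hm => ?_⟩
        obtain ⟨b, hb, h⟩ := h2 hm
        exact ⟨b, (eF _ _).2 ⟨k, hb⟩, h⟩

open Nat.Partrec in
theorem exists_functional {X : Cantor} {f : ℕ →. ℕ} (hf : Nat.RecursiveIn {X.toPFun} f) :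
    ∃ e, turingFunctional e X = f := by
  obtain ⟨F, pF, mF, eF⟩ := exists_approx hf
  have : Nat.Partrec fun p : ℕ => F ((Encodable.decode (α := List Bool) p.unpair.1).getD []) p.unpair.2 := by
    refine Partrec.nat_iff.1 ?_
    refine pF.comp ?_ (Computable.snd.comp Computable.unpair)
    exact (Primrec.option_getD.comp (Primrec.decode.comp (Primrec.fst.comp Primrec.unpair))
      (Primrec.const [])).to_comp
  obtain ⟨c, hc⟩ := Code.exists_code.1 this
  refine ⟨Encodable.encode c, ?_⟩
  funext n
  have hdec : Denumerable.ofNat Code (Encodable.encode c) = c := Denumerable.ofNat_encode c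
  have key : ∀ v k t, v ∈ Code.evaln t c (Nat.pair (Encodable.encode (X.initSeg k)) n) →
      v ∈ f n := by
    intro v k t h
    have := Code.evaln_sound h
    rw [hc] at this
    simp at this
    exact (eF _ _).2 ⟨k, this⟩
  apply Part.ext
  intro v
  constructor
  · intro h
    obtain ⟨s, hs⟩ := Nat.rfindOpt_spec h
    rw [hdec] at hs
    exact key _ _ _ hs
  · intro h
    obtain ⟨k, hk⟩ := (eF _ _).1 h
    have h1 : v ∈ Code.eval c (Nat.pair (Encodable.encode (X.initSeg k)) n) := by
      rw [hc]; simpa using hk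
    obtain ⟨t, ht⟩ := Code.evaln_complete.1 h1
    have hd : (turingFunctional (Encodable.encode c) X n).Dom := by
      refine Nat.rfindOpt_dom.2 ⟨Nat.pair k t, v, ?_⟩
      rw [hdec]; simpa using ht
    obtain ⟨w, hw⟩ := Part.dom_iff_mem.1 hd
    obtain ⟨s, hs⟩ := Nat.rfindOpt_spec hw
    rw [hdec] at hs
    rw [Part.mem_unique h (key _ _ _ hs)]
    exact hw


open Nat.Partrec in
theorem functional_recursive (e : ℕ) (X : Cantor) :
    Nat.RecursiveIn {X.toPFun} (turingFunctional e X) := by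
  have hX : Nat.RecursiveIn {X.toPFun} X.toPFun := .oracle _ rfl
  have hP : Nat.RecursiveIn {X.toPFun}
      (fun k => Part.some (Encodable.encode (X.initSeg k))) := by
    let app : ℕ → ℕ := fun q => Encodable.encode
      ((Encodable.decode (α := List Bool) q.unpair.1).getD [] ++ [decide (q.unpair.2 = 1)])
    have happ : Primrec app := by
      refine Primrec.encode.comp (Primrec.list_append.comp
        (Primrec.option_getD.comp (Primrec.decode.comp (Primrec.fst.comp Primrec.unpair))
          (Primrec.const [])) (Primrec.list_cons.comp ?_ (Primrec.const [])))
      exact Primrec.eq.decide.comp (Primrec.snd.comp Primrec.unpair) (Primrec.const 1)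
    have h0 : Nat.RecursiveIn {X.toPFun} (fun _ => Part.some (Encodable.encode ([] : List Bool))) :=
      Nat.Primrec.recursiveIn (Nat.Primrec.const _)
    have hy : Nat.RecursiveIn {X.toPFun}
        (fun p => Part.some p.unpair.2.unpair.1) :=
      Nat.Primrec.recursiveIn (Nat.Primrec.left.comp Nat.Primrec.right)
    have hi : Nat.RecursiveIn {X.toPFun}
        (fun p => Part.some p.unpair.2.unpair.2) :=
      Nat.Primrec.recursiveIn (Nat.Primrec.right.comp Nat.Primrec.right)
    have hs := Nat.RecursiveIn.comp (Nat.Primrec.recursiveIn (O := {X.toPFun})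
      (Primrec.nat_iff.1 happ)) (Nat.RecursiveIn.pair hi (Nat.RecursiveIn.comp hX hy))
    have hr := Nat.RecursiveIn.prec h0 hs
    have hq : Nat.RecursiveIn {X.toPFun} (fun k => Part.some (Nat.pair 0 k)) :=
      Nat.Primrec.recursiveIn ((Nat.Primrec.const 0).pair Nat.Primrec.id)
    refine (hr.comp hq).of_eq fun k => ?_
    simp [Seq.seq]
    induction k with
    | zero => simp [Cantor.initSeg]
    | succ k ih =>
      simp only [] at ih ⊢
      rw [ih]
      simp [app, Cantor.initSeg, List.range_succ]
      have hk : ((Part.some k).bind fun y => X.toPFun y) = Part.some (X k).toNat :=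
        Part.bind_some _ _
      refine (congrArg (fun p : Part ℕ => p.bind fun y => Part.some (Encodable.encode
        (List.map X (List.range k) ++ [decide (y = 1)]))) hk).trans ?_
      simp only [Part.bind_some]
      cases X k <;> simp
  let ev : ℕ → Option ℕ := fun q => Code.evaln q.unpair.1 (Denumerable.ofNat Code e) q.unpair.2
  have hev : Primrec ev := Code.primrec_evaln.comp
    (((Primrec.fst.comp Primrec.unpair).pair (Primrec.const _)).pair
      (Primrec.snd.comp Primrec.unpair))
  -- `inp ⟨n, s⟩ = ⟨t, ⟨X ↾ k, n⟩⟩` for `s = ⟨k, t⟩`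
  let inp : ℕ → ℕ := fun p => Nat.pair p.unpair.2.unpair.2
    (Nat.pair (Encodable.encode (X.initSeg p.unpair.2.unpair.1)) p.unpair.1)
  have hinp : Nat.RecursiveIn {X.toPFun} (fun p => Part.some (inp p)) := by
    have h1 : Nat.RecursiveIn {X.toPFun} (fun p => Part.some p.unpair.2.unpair.1) :=
      Nat.Primrec.recursiveIn (Nat.Primrec.left.comp Nat.Primrec.right)
    have h2 : Nat.RecursiveIn {X.toPFun} (fun p => Part.some p.unpair.2.unpair.2) :=
      Nat.Primrec.recursiveIn (Nat.Primrec.right.comp Nat.Primrec.right)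
    have h3 : Nat.RecursiveIn {X.toPFun} (fun p => Part.some p.unpair.1) :=
      Nat.Primrec.recursiveIn Nat.Primrec.left
    refine (h2.pair ((hP.comp h1).pair h3)).of_eq fun p => ?_
    simp [Seq.seq, inp]
  have t1 : Primrec fun q => cond (ev q).isSome 0 1 :=
    Primrec.cond (Primrec.option_isSome.comp hev) (Primrec.const 0) (Primrec.const 1)
  have t2 : Primrec fun q => (ev q).getD 0 := Primrec.option_getD.comp hev (Primrec.const 0)
  have hf := Nat.RecursiveIn.rfind (((Primrec.nat_iff.1 t1).recursiveIn).comp hinp)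
  have hid : Nat.RecursiveIn {X.toPFun} (fun p => Part.some p) :=
    Nat.Primrec.recursiveIn Nat.Primrec.id
  refine (((Primrec.nat_iff.1 t2).recursiveIn.comp hinp).comp (hid.pair hf)).of_eq fun n => ?_
  have hb : ∀ s, Code.evaln s.unpair.2 (Denumerable.ofNat Code e)
      (Nat.pair (Encodable.encode (X.initSeg s.unpair.1)) n) = ev (inp (Nat.pair n s)) := by
    intro s; simp [ev, inp]
  simp only [turingFunctional, hb, Nat.rfindOpt]
  simp [Seq.seq]
  have hc : ∀ s, decide ((bif (ev (inp (Nat.pair n s))).isSome then 0 else 1) = 0) =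
      (ev (inp (Nat.pair n s))).isSome := by
    intro s
    cases (ev (inp (Nat.pair n s))).isSome <;> simp
  simp only [hc]
  refine Part.ext fun v => ?_
  simp only [Part.mem_bind_iff, Part.mem_some_iff, Part.mem_coe]
  refine exists_congr fun s => and_congr_right fun hs => ?_
  have := Nat.rfind_spec hs
  simp only [Part.mem_some_iff] at this
  obtain ⟨w, hw⟩ := Option.isSome_iff_exists.1 this.symm
  simp [hw, eq_comm]

/-- For every real `X`, the functions `Φ_e^X` are exactly the partial functions recursive in `X`. -/
theorem adequate (X : Cantor) (f : ℕ →. ℕ) :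
    (∃ e, turingFunctional e X = f) ↔ TuringReducible f X.toPFun :=
  ⟨fun ⟨e, he⟩ => RecursiveIn.iff_nat.2 (he ▸ functional_recursive e X),
    fun h => exists_functional (RecursiveIn.iff_nat.1 h)⟩

end TuringFunctional

open Classical in
/-- The Turing jump `X' = {e : Φ_e^X(e)↓}`. -/
noncomputable def turingJump (X : Cantor) : Cantor :=
  fun e => decide (turingFunctional e X e).Dom

/-- `H` is a jump hierarchy supported on `≺`: for all `n`, `H^[n]` is the jump of `H^[≺n]`, where
`[≺n] = {m : m ≺ n}`. -/
def IsJumpHierarchy (prec : ℕ → ℕ → Prop) (H : Cantor) : Prop :=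
  ∀ n, H.column n = turingJump (H.columns {m | prec m n})

/-- `(ω, ≺)` is a computable presentation of the ordinal `α`: `≺` is a computable relation which
well-orders `ω` in order type `α`. -/
def IsComputablePresentation (prec : ℕ → ℕ → Prop) (α : Ordinal.{0}) : Prop :=
  ComputablePred (fun p : ℕ × ℕ => prec p.1 p.2) ∧
    ∃ _ : IsWellOrder ℕ prec, Ordinal.type prec = α

/-- `x ≡_≺ y` if `x = y`, or `x^[1] = y^[1]` is a jump hierarchy supported on `≺`. -/
def jumpEquiv (prec : ℕ → ℕ → Prop) : Setoid Cantor where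
  r x y := x = y ∨ (x.column 1 = y.column 1 ∧ IsJumpHierarchy prec (x.column 1))
  iseqv :=
    { refl := fun _ => Or.inl rfl
      symm := by
        rintro x y (rfl | ⟨h, hH⟩)
        · exact Or.inl rfl
        · exact Or.inr ⟨h.symm, h ▸ hH⟩
      trans := by
        rintro x y z (rfl | ⟨h, hH⟩) (rfl | ⟨h', hH'⟩)
        · exact Or.inl rfl
        · exact Or.inr ⟨h', hH'⟩
        · exact Or.inr ⟨h, hH⟩
        · exact Or.inr ⟨h.trans h', hH⟩ }

/-- `(l_n)` is a learner for `E`: the `l_n : X^ω × X → ω` are continuous (with `ω` discrete), and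
whenever `x E x_i` for some `i`, the limit `L = lim l_n(x⃗, x)` exists and `x E x_L`. -/
def IsLearner {X : Type*} [TopologicalSpace X] (E : Setoid X) (l : ℕ → (ℕ → X) × X → ℕ) : Prop :=
  (∀ n, Continuous (l n)) ∧
    ∀ (xs : ℕ → X) (x : X), (∃ i, E x (xs i)) →
      ∃ L : ℕ, Tendsto (fun n => l n (xs, x)) atTop (𝓝 L) ∧ E x (xs L)

/-- Uniform learnability of an equivalence relation. -/
def UniformlyLearnable {X : Type*} [TopologicalSpace X] (E : Setoid X) : Prop :=
  ∃ l : ℕ → (ℕ → X) × X → ℕ, IsLearner E l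

/-- The (partial) operator `Φ_e^z : (2^ω)^ω × 2^ω → ω` with index `e` and parameter `z`: it maps
`(x⃗, x)` to `Φ_e^{z ⊕ (x⃗ ⊕ x)}(0)`. -/
def turingOperator (e : ℕ) (z : Cantor) : (ℕ → Cantor) × Cantor →. ℕ := fun p =>
  turingFunctional e (z.join ((Cantor.seqJoin p.1).join p.2)) 0

/-- `(l_n)` is `z`-computable: there is a `z`-recursive `f : ω → ω` with `Φ_{f(n)}^z = l_n` for
all `n`. -/
def IsComputableLearner (z : Cantor) (l : ℕ → (ℕ → Cantor) × Cantor → ℕ) : Prop :=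
  ∃ f : ℕ → ℕ, TuringReducible (f : ℕ →. ℕ) z.toPFun ∧
    ∀ n, turingOperator (f n) z = (l n : (ℕ → Cantor) × Cantor →. ℕ)

/-- `E` is `z`-learnable: it has a `z`-computable learner. -/
def LearnableWithOracle (z : Cantor) (E : Setoid Cantor) : Prop :=
  ∃ l : ℕ → (ℕ → Cantor) × Cantor → ℕ, IsLearner E l ∧ IsComputableLearner z l

/-! By well-founded recursion there is exactly one jump hierarchy `H`
(`existsUnique_isJumpHierarchy`), so `≡_≺` relates `x` and `y` iff `x = y` or both have `H` in
column 1. Such a relation is learnable: guess the least `i` for which `x_i` looks equivalent to `x`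
on the first `n` bits (`uniformlyLearnable_of_column`).

For the lower bound, put one real `G` into column 1 of `x` and of every `x_i`, leaving the other
bits, given by a real `Y`, free. If `G = H`, all entries are equivalent, so the learner converges on
every `Y`; by Baire category there are `n`, `L` and a string `τ` such that its guess is `L` for
every `Y` extending `τ` from stage `n` on (`IsLearner.exists_eventually_const`). If `G ≠ H`, the
relation on these inputs is equality, and some `Y` extending `τ` has `x` equal to an entry but not
to `x_L`, so that a guess other than `L` occurs after stage `n` (`IsLearner.exists_ne`).

Hence `G ≠ H` iff such a guess occurs for some `Y` extending `τ`. For a `z`-computable learner this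
condition is `Σ⁰₁(z)` (`exists_primrecRel_of_computableLearner`), so `{H}` is a `Π⁰₁(z)` class, and
by compactness its only member is computable from `z` (`turingReducible_of_pi01_singleton`). -/

/-! ### Strings, initial segments and bounded search -/

theorem Cantor.initSeg_eq_iff {X Y : Cantor} {k : ℕ} :
    X.initSeg k = Y.initSeg k ↔ ∀ i < k, X i = Y i := by
  simp [Cantor.initSeg]

theorem Cantor.take_initSeg (X : Cantor) {j k : ℕ} (h : j ≤ k) :
    (X.initSeg k).take j = X.initSeg j := by
  obtain ⟨d, rfl⟩ := Nat.exists_eq_add_of_le h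
  simp [Cantor.initSeg, List.range_add]

theorem Cantor.initSeg_getElem? (X : Cantor) {j k : ℕ} (h : j < k) :
    (X.initSeg k)[j]? = some (X j) := by
  simp [Cantor.initSeg, h]

theorem Cantor.length_initSeg (X : Cantor) (k : ℕ) : (X.initSeg k).length = k := by
  simp [Cantor.initSeg]

/-- The real whose first bits are given by a string, and whose other bits vanish. -/
def Cantor.ofList (s : List Bool) : Cantor := fun i => s.getD i false

theorem Cantor.ofList_apply_initSeg (X : Cantor) {j k : ℕ} (h : j < k) :
    Cantor.ofList (X.initSeg k) j = X j := by
  simp [Cantor.ofList, X.initSeg_getElem? h]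

theorem Cantor.initSeg_ofList (s : List Bool) : (Cantor.ofList s).initSeg s.length = s := by
  apply List.ext_getElem
  · simp [Cantor.initSeg]
  · intro i h1 h2
    simp [Cantor.initSeg, Cantor.ofList, h2]

theorem Cantor.isOpen_setOf_initSeg (k : ℕ) (P : List Bool → Prop) :
    IsOpen {X : Cantor | P (X.initSeg k)} := by
  refine (PiNat.isTopologicalBasis_cylinders (fun _ => Bool)).isOpen_iff.2 fun X hX => ?_
  refine ⟨_, ⟨X, k, rfl⟩, PiNat.self_mem_cylinder X k, fun Y hY => ?_⟩
  have : Cantor.initSeg Y k = Cantor.initSeg X k := Cantor.initSeg_eq_iff.2 hY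
  rw [Set.mem_ofPred_eq, this]
  exact hX

theorem PrimrecRel.exists_nat_lt {β : Type*} [Primcodable β] {R : ℕ → β → Prop}
    (hR : PrimrecRel R) : PrimrecRel fun n y => ∃ x < n, R x y :=
  (hR.exists_mem_list.comp (Primrec.list_range.comp Primrec.fst) Primrec.snd).of_eq (by simp)

/-- The list of all strings of a given length. -/
def allStrings (n : ℕ) : List (List Bool) :=
  n.rec [[]] fun _ l => l.map (· ++ [false]) ++ l.map (· ++ [true])

theorem primrec_allStrings : Primrec allStrings := by
  have h : ∀ b : Bool, Primrec fun p : ℕ × List (List Bool) => p.2.map (· ++ [b]) := fun b =>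
    Primrec.list_map Primrec.snd
      (Primrec.list_append.comp Primrec.snd (Primrec.const [b])).to₂
  exact Primrec.nat_rec₁ [[]] (Primrec.list_append.comp (h false) (h true)).to₂

theorem initSeg_mem_allStrings (X : Cantor) (n : ℕ) : X.initSeg n ∈ allStrings n := by
  induction n with
  | zero => simp [allStrings, Cantor.initSeg]
  | succ n ih =>
    have h : X.initSeg (n + 1) = X.initSeg n ++ [X n] := by
      simp [Cantor.initSeg, List.range_succ]
    have h2 : allStrings (n + 1) =
      (allStrings n).map (· ++ [false]) ++ (allStrings n).map (· ++ [true]) := rfl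
    rw [h, h2, List.mem_append, List.mem_map, List.mem_map]
    cases X n
    · exact Or.inl ⟨_, ih, rfl⟩
    · exact Or.inr ⟨_, ih, rfl⟩

theorem length_of_mem_allStrings {n : ℕ} {s : List Bool} (h : s ∈ allStrings n) :
    s.length = n := by
  induction n generalizing s with
  | zero => simp_all [allStrings]
  | succ n ih =>
    have h2 : allStrings (n + 1) =
      (allStrings n).map (· ++ [false]) ++ (allStrings n).map (· ++ [true]) := rfl
    rw [h2, List.mem_append, List.mem_map, List.mem_map] at h
    rcases h with ⟨t, ht, rfl⟩ | ⟨t, ht, rfl⟩ <;> simp [ih ht]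

/-! ### Functionals from approximations; members of `Π⁰₁` singletons -/

-- Search all pairs of a length `k` and a time bound. Whatever value is found lies in `f n`, which
-- has at most one element, so `F` need not be monotone in the string.
open Nat.Partrec in
theorem exists_functional_of_approx {X : Cantor} {f : ℕ →. ℕ} {F : List Bool → ℕ →. ℕ}
    (pF : Partrec₂ F) (eF : ∀ n v, v ∈ f n ↔ ∃ k, v ∈ F (X.initSeg k) n) :
    ∃ e, turingFunctional e X = f := by
  have : Nat.Partrec fun p : ℕ =>
      F ((Encodable.decode (α := List Bool) p.unpair.1).getD []) p.unpair.2 := by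
    refine Partrec.nat_iff.1 (pF.comp ?_ (Computable.snd.comp Computable.unpair))
    exact (Primrec.option_getD.comp (Primrec.decode.comp (Primrec.fst.comp Primrec.unpair))
      (Primrec.const [])).to_comp
  obtain ⟨c, hc⟩ := Code.exists_code.1 this
  refine ⟨Encodable.encode c, ?_⟩
  funext n
  have hdec : Denumerable.ofNat Code (Encodable.encode c) = c := Denumerable.ofNat_encode c
  have key : ∀ v k t, v ∈ Code.evaln t c (Nat.pair (Encodable.encode (X.initSeg k)) n) →
      v ∈ f n := by
    intro v k t h
    have := Code.evaln_sound h
    rw [hc] at this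
    exact (eF _ _).2 ⟨k, by simpa using this⟩
  refine Part.ext fun v => ⟨fun h => ?_, fun h => ?_⟩
  · obtain ⟨s, hs⟩ := Nat.rfindOpt_spec h
    rw [hdec] at hs
    exact key _ _ _ hs
  · obtain ⟨k, hk⟩ := (eF _ _).1 h
    have h1 : v ∈ Code.eval c (Nat.pair (Encodable.encode (X.initSeg k)) n) := by
      rw [hc]; simpa using hk
    obtain ⟨t, ht⟩ := Code.evaln_complete.1 h1
    have hd : (turingFunctional (Encodable.encode c) X n).Dom :=
      Nat.rfindOpt_dom.2 ⟨Nat.pair k t, v, by rw [hdec]; simpa using ht⟩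
    obtain ⟨w, hw⟩ := Part.dom_iff_mem.1 hd
    obtain ⟨s, hs⟩ := Nat.rfindOpt_spec hw
    rw [hdec] at hs
    rw [Part.mem_unique h (key _ _ _ hs)]
    exact hw

open Nat.Partrec in
/-- A projection of a recursively enumerable set is the projection of a primitive recursive
relation. -/
theorem exists_primrecRel_iff {α : Type*} [Primcodable α] {V : α → ℕ →. Bool}
    (hV : Partrec₂ V) :
    ∃ R : α → ℕ → Prop, PrimrecRel R ∧ ∀ a, (∃ T, R a T) ↔ ∃ w, true ∈ V a w := by
  obtain ⟨c, hc⟩ := Code.exists_code.1 hV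
  have hmem : ∀ (a : α) (w : ℕ) (b : Bool),
      Encodable.encode b ∈ c.eval (Encodable.encode (a, w)) ↔ b ∈ V a w := by
    intro a w b
    rw [hc]
    simp
  -- `T` codes a witness `w` together with a bound on the running time.
  refine ⟨fun a T => Code.evaln T.unpair.2 c (Encodable.encode (a, T.unpair.1)) =
    some (Encodable.encode true), ?_, fun a => ⟨?_, ?_⟩⟩
  · refine Primrec.eq.comp (Code.primrec_evaln.comp (((Primrec.snd.comp
      (Primrec.unpair.comp Primrec.snd)).pair (Primrec.const c)).pair
      (Primrec.encode.comp (Primrec.fst.pair (Primrec.fst.comp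
        (Primrec.unpair.comp Primrec.snd)))))) (Primrec.const _)
  · rintro ⟨T, hT⟩
    exact ⟨T.unpair.1, (hmem _ _ _).1 (Code.evaln_sound hT)⟩
  · rintro ⟨w, hw⟩
    obtain ⟨t, ht⟩ := Code.evaln_complete.1 ((hmem _ _ _).2 hw)
    exact ⟨Nat.pair w t, by simpa using ht⟩

/-- The unique member of a `Π⁰₁(z)` class in Cantor space is computable from `z`. -/
theorem turingReducible_of_pi01_singleton {z H : Cantor} {R : List Bool × List Bool → ℕ → Prop}
    (hR : PrimrecRel R)
    (hH : ∀ G : Cantor, G ≠ H ↔ ∃ j T, R (z.initSeg j, G.initSeg j) T) :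
    TuringReducible H.toPFun z.toPFun := by
  -- `test (s, k, b) T`: each string `g` of the length of `s` has bit `b` at `k`, or is refuted by
  -- `R` with `s` in place of `z` and a witness below `T`.
  let test : (List Bool × ℕ × Bool) → ℕ → Prop := fun a T =>
    ∀ g ∈ allStrings a.1.length, g[a.2.1]? = some a.2.2 ∨
      ∃ j < a.1.length + 1, ∃ T' < T, R (a.1.take j, g.take j) T'
  have htest : PrimrecRel test := by
    have h1 : PrimrecRel fun (T' : ℕ) (q : ℕ × List Bool × List Bool) =>
        R (q.2.1.take q.1, q.2.2.take q.1) T' := by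
      refine hR.comp (Primrec.pair ?_ ?_) Primrec.fst
      · exact Primrec.list_take.comp (Primrec.fst.comp Primrec.snd)
          (Primrec.fst.comp (Primrec.snd.comp Primrec.snd))
      · exact Primrec.list_take.comp (Primrec.fst.comp Primrec.snd)
          (Primrec.snd.comp (Primrec.snd.comp Primrec.snd))
    have h2 : PrimrecRel fun (j : ℕ) (q : ℕ × List Bool × List Bool) =>
        ∃ T' < q.1, R (q.2.1.take j, q.2.2.take j) T' := 
      h1.exists_nat_lt.comp (f := fun p : ℕ × ℕ × List Bool × List Bool => p.2.1)
        (g := fun p => (p.1, p.2.2)) (Primrec.fst.comp Primrec.snd)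
        (Primrec.fst.pair (Primrec.snd.comp Primrec.snd))
    have h3 : PrimrecRel fun (g : List Bool) (p : (List Bool × ℕ × Bool) × ℕ) =>
        g[p.1.2.1]? = some p.1.2.2 ∨
          ∃ j < p.1.1.length + 1, ∃ T' < p.2, R (p.1.1.take j, g.take j) T' := by
      have hp := Primrec.fst.comp
        (Primrec.snd (α := List Bool) (β := (List Bool × ℕ × Bool) × ℕ))
      refine PrimrecPred.or ?_ ?_
      · exact Primrec.eq.comp (Primrec.list_getElem?.comp Primrec.fst
          (Primrec.fst.comp (Primrec.snd.comp hp)))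
          (Primrec.option_some.comp (Primrec.snd.comp (Primrec.snd.comp hp)))
      · exact h2.exists_nat_lt.comp
          (f := fun p : List Bool × (List Bool × ℕ × Bool) × ℕ => p.2.1.1.length + 1)
          (g := fun p => (p.2.2, p.2.1.1, p.1)) (Primrec.succ.comp (Primrec.list_length.comp
          (Primrec.fst.comp hp))) ((Primrec.snd.comp Primrec.snd).pair
            ((Primrec.fst.comp hp).pair Primrec.fst))
    exact h3.forall_mem_list.comp (primrec_allStrings.comp
      (Primrec.list_length.comp (Primrec.fst.comp Primrec.fst))) Primrec.id
  -- The initial segment of `H` is never refuted, so it must be a string with bit `b` at `k`.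
  have sound : ∀ N k b T, test (z.initSeg N, k, b) T → H k = b := by
    intro N k b T h
    rcases h (H.initSeg N) (by simpa [Cantor.length_initSeg] using initSeg_mem_allStrings H N)
      with h | ⟨j, hj, T', -, h⟩
    · by_cases hk : k < N
      · simpa [H.initSeg_getElem? hk] using h
      · simp [Cantor.initSeg, hk] at h
    · simp only [Cantor.length_initSeg, Nat.lt_succ_iff] at hj
      rw [Cantor.take_initSeg _ hj, Cantor.take_initSeg _ hj] at h
      exact absurd rfl ((hH H).2 ⟨j, T', h⟩)
  -- The reals that differ from `H` at `k` form a compact set covered by the open sets of refuted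
  -- reals; finitely many refutations suffice.
  have complete : ∀ k, ∃ N T, test (z.initSeg N, k, H k) T := by
    intro k
    have hK : IsCompact {G : Cantor | G k ≠ H k} := by
      exact (IsClosed.preimage (f := fun G : Cantor => G k) (continuous_apply k)
        (isClosed_discrete {b : Bool | b ≠ H k})).isCompact
    obtain ⟨S, hS⟩ := hK.elim_finite_subcover
      (fun p : ℕ × ℕ => {G : Cantor | R (z.initSeg p.1, G.initSeg p.1) p.2})
      (fun p => Cantor.isOpen_setOf_initSeg p.1 fun g => R (z.initSeg p.1, g) p.2) (by
        intro G hG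
        obtain ⟨j, T, h⟩ := (hH G).1 fun h => hG (h ▸ rfl)
        exact Set.mem_iUnion.2 ⟨(j, T), h⟩)
    -- `k + 1` makes bit `k` visible, the suprema bound the finitely many refutations, and the last
    -- `+ 1` is there because witnesses are strictly below `T`.
    refine ⟨max (k + 1) (S.sup Prod.fst), S.sup Prod.snd + 1, fun g hg => ?_⟩
    simp only [Cantor.length_initSeg] at hg ⊢
    generalize hN : max (k + 1) (S.sup Prod.fst) = N at hg ⊢
    have hgl := length_of_mem_allStrings hg
    have hgN : (Cantor.ofList g).initSeg N = g := by
      rw [← hgl]; exact Cantor.initSeg_ofList g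
    by_cases hb : Cantor.ofList g k = H k
    · left
      rw [← hgN, Cantor.initSeg_getElem? _ (by omega), hb]
    · right
      obtain ⟨p, hp, hR'⟩ := Set.mem_iUnion₂.1 (hS hb)
      have h1 : p.1 ≤ N := hN ▸ (Finset.le_sup (f := Prod.fst) hp).trans (le_max_right _ _)
      refine ⟨p.1, by omega, p.2, Nat.lt_succ_of_le (Finset.le_sup (f := Prod.snd) hp), ?_⟩
      rw [Cantor.take_initSeg _ h1, ← hgN, Cantor.take_initSeg _ h1]
      exact hR'
  classical
  have hdec := htest.decide
  -- By `sound` at most one of the two bits can pass, so the order of the tests is immaterial.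
  let F : List Bool → ℕ →. ℕ := fun s k => Nat.rfindOpt fun T =>
    bif decide (test (s, k, false) T) then some 0 else
      bif decide (test (s, k, true) T) then some 1 else none
  have pF : Partrec₂ F := by
    have h : ∀ b : Bool, Primrec fun p : (List Bool × ℕ) × ℕ =>
        decide (test (p.1.1, p.1.2, b) p.2) := fun b =>
      hdec.comp ((Primrec.fst.comp Primrec.fst).pair
        ((Primrec.snd.comp Primrec.fst).pair (Primrec.const b))) Primrec.snd
    exact Partrec.rfindOpt (Primrec.cond (h false) (Primrec.const _)
      (Primrec.cond (h true) (Primrec.const _) (Primrec.const _))).to_comp.to₂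
  have key : ∀ N k v, v ∈ F (z.initSeg N) k → v = (H k).toNat := by
    intro N k v hv
    obtain ⟨T, hT⟩ := Nat.rfindOpt_spec hv
    by_cases h0 : test (z.initSeg N, k, false) T
    · simp [h0] at hT
      simp [sound _ _ _ _ h0, ← hT]
    · by_cases h1 : test (z.initSeg N, k, true) T
      · simp [h0, h1] at hT
        simp [sound _ _ _ _ h1, ← hT]
      · simp [h0, h1] at hT
  refine (TuringFunctional.adequate z _).1 (exists_functional_of_approx pF fun k v => ?_)
  simp only [Cantor.toPFun, Part.mem_some_iff]
  refine ⟨?_, fun ⟨N, hN⟩ => key _ _ _ hN⟩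
  rintro rfl
  obtain ⟨N, T, hT⟩ := complete k
  have hd : (F (z.initSeg N) k).Dom := by
    refine Nat.rfindOpt_dom.2 ⟨T, ?_⟩
    by_cases h0 : test (z.initSeg N, k, false) T
    · exact ⟨0, by simp [h0]⟩
    · refine ⟨1, ?_⟩
      have : H k = true := by
        cases h : H k
        · exact absurd (h ▸ hT) h0
        · rfl
      rw [this] at hT
      simp [h0, hT]
  obtain ⟨w, hw⟩ := Part.dom_iff_mem.1 hd
  exact ⟨N, key _ _ _ hw ▸ hw⟩

/-! ### Coding inputs by one real, with a prescribed column -/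

namespace Cantor

/-- The input `(x⃗, x)` with `x⃗ ⊕ x = W`. -/
def toInput (W : Cantor) : (ℕ → Cantor) × Cantor :=
  (fun i k => W (2 * Nat.pair i k), fun k => W (2 * k + 1))

/-- The oracle of `turingOperator` on the input `W.toInput` is therefore just `z ⊕ W`. -/
theorem join_toInput (W : Cantor) : (seqJoin W.toInput.1).join W.toInput.2 = W := by
  funext r
  by_cases h : r % 2 = 0
  · simp only [join, h, if_true, seqJoin, toInput, Nat.pair_unpair]
    congr 1; omega
  · simp only [join, h, if_false, toInput]
    congr 1; omega

/-- The position in its component of the bit of `x⃗ ⊕ x` with index `r`. -/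
def position (r : ℕ) : ℕ := if r % 2 = 0 then (r / 2).unpair.2 else r / 2

theorem position_even (i k : ℕ) : position (2 * Nat.pair i k) = k := by simp [position]

theorem position_odd (k : ℕ) : position (2 * k + 1) = k := by
  simp only [position]
  rw [if_neg (by omega)]
  omega

theorem position_le (r : ℕ) : position r ≤ r := by
  unfold position
  split
  · exact (Nat.unpair_right_le _).trans (Nat.div_le_self _ _)
  · exact Nat.div_le_self _ _

/-- `Y`, viewed as `x⃗ ⊕ x`, with `G` put in the column with index `1` of `x` and of each `x_i`. -/
def insertColumn (G Y : Cantor) : Cantor := fun r =>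
  if (position r).unpair.1 = 1 then G (position r).unpair.2 else Y r

theorem column_toInput_insertColumn_fst (G Y : Cantor) (i : ℕ) :
    ((insertColumn G Y).toInput.1 i).column 1 = G := by
  funext k
  simp [toInput, insertColumn, column, position_even]

theorem column_toInput_insertColumn_snd (G Y : Cantor) :
    (insertColumn G Y).toInput.2.column 1 = G := by
  funext k
  simp [toInput, insertColumn, column, position_odd]

theorem continuous_toInput_insertColumn (G : Cantor) :
    Continuous fun Y => (insertColumn G Y).toInput := by
  have h : ∀ r, Continuous fun Y => insertColumn G Y r := fun r => by
    unfold insertColumn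
    split
    · exact continuous_const
    · exact continuous_apply r
  exact (continuous_pi fun i => continuous_pi fun k => h _).prodMk (continuous_pi fun k => h _)

/-- Halving, `position` and unpairing never increase an index, so bit `i` of the join depends on `z`
and `G` only at indices up to `i`. -/
theorem join_insertColumn_congr {z z' G G' : Cantor} (Y : Cantor) {k : ℕ}
    (hz : ∀ i < k, z i = z' i) (hG : ∀ i < k, G i = G' i) :
    ∀ i < k, z.join (insertColumn G Y) i = z'.join (insertColumn G' Y) i := by
  intro i hi
  have hi2 : i / 2 < k := (Nat.div_le_self _ _).trans_lt hi
  unfold join insertColumn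
  rw [hz _ hi2, hG _ (((Nat.unpair_right_le _).trans (position_le _)).trans_lt hi2)]

theorem join_insertColumn_congr_right (z G : Cantor) {Y Y' : Cantor} {k : ℕ}
    (hY : ∀ i < k, Y i = Y' i) :
    ∀ i < k, z.join (insertColumn G Y) i = z.join (insertColumn G Y') i := by
  intro i hi
  unfold join insertColumn
  rw [hY _ ((Nat.div_le_self _ _).trans_lt hi)]

theorem primrec_position : Primrec position :=
  Primrec.ite (Primrec.eq.comp (Primrec.nat_mod.comp Primrec.id (Primrec.const 2))
      (Primrec.const 0))
    (Primrec.snd.comp (Primrec.unpair.comp (Primrec.nat_div.comp Primrec.id (Primrec.const 2))))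
    (Primrec.nat_div.comp Primrec.id (Primrec.const 2))

theorem primrec_join_insertColumn_ofList :
    Primrec fun p : (List Bool × List Bool × List Bool) × ℕ =>
      (ofList p.1.1).join (insertColumn (ofList p.1.2.1) (ofList p.1.2.2)) p.2 := by
  have h2 : Primrec fun p : (List Bool × List Bool × List Bool) × ℕ => p.2 / 2 :=
    Primrec.nat_div.comp Primrec.snd (Primrec.const 2)
  have hu := Primrec.unpair.comp (primrec_position.comp h2)
  refine Primrec.ite (Primrec.eq.comp (Primrec.nat_mod.comp Primrec.snd (Primrec.const 2))
      (Primrec.const 0)) ((Primrec.list_getD false).comp (Primrec.fst.comp Primrec.fst) h2) ?_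
  exact Primrec.ite (Primrec.eq.comp (Primrec.fst.comp hu) (Primrec.const 1))
    ((Primrec.list_getD false).comp (Primrec.fst.comp (Primrec.snd.comp Primrec.fst))
      (Primrec.snd.comp hu))
    ((Primrec.list_getD false).comp (Primrec.snd.comp (Primrec.snd.comp Primrec.fst)) h2)

end Cantor

/-! ### Wrong guesses of a computable learner as a `Σ⁰₁` event -/

open Nat.Partrec in
/-- The `s`-th attempt in the computation of `Φ_e^X(0)`. -/
def functionalStep (e : ℕ) (X : Cantor) (s : ℕ) : Option ℕ :=
  Code.evaln s.unpair.2 (Denumerable.ofNat Code e)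
    (Nat.pair (Encodable.encode (X.initSeg s.unpair.1)) 0)

/-- Attempt `s = ⟨k, t⟩` reads only `k ≤ s` bits, so `s` itself bounds the use. -/
theorem functionalStep_congr (e : ℕ) {X Y : Cantor} {s : ℕ} (h : ∀ i < s, X i = Y i) :
    functionalStep e X s = functionalStep e Y s := by
  unfold functionalStep
  rw [Cantor.initSeg_eq_iff.2 fun i hi => h i (hi.trans_le (Nat.unpair_left_le s))]

theorem mem_rfind_isSome {g : ℕ → Option ℕ} {s : ℕ} :
    s ∈ Nat.rfind (fun s => Part.some (g s).isSome) ↔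
      (∃ v, g s = some v) ∧ ∀ s' < s, g s' = none := by
  refine Nat.mem_rfind.trans (and_congr ?_ (forall_congr' fun s' => imp_congr_right fun _ => ?_))
  · exact Part.mem_some_iff.trans (eq_comm.trans Option.isSome_iff_exists)
  · exact Part.mem_some_iff.trans (eq_comm.trans Option.isSome_eq_false_iff |>.trans
      Option.isNone_iff_eq_none)

theorem mem_turingFunctional_zero {e : ℕ} {X : Cantor} {v : ℕ} :
    v ∈ turingFunctional e X 0 ↔
      ∃ s, functionalStep e X s = some v ∧ ∀ s' < s, functionalStep e X s' = none := by
  change v ∈ Nat.rfindOpt (functionalStep e X) ↔ _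
  change v ∈ (Nat.rfind fun s => Part.some (functionalStep e X s).isSome).bind _ ↔ _
  simp only [Part.mem_bind_iff, mem_rfind_isSome]
  constructor
  · rintro ⟨s, ⟨-, h⟩, hv⟩
    exact ⟨s, by simpa using hv, h⟩
  · rintro ⟨s, hv, h⟩
    exact ⟨s, ⟨⟨v, hv⟩, h⟩, by simpa using hv⟩

open Nat.Partrec in
theorem primrec_functionalStep_ofList :
    Primrec fun p : (List Bool × List Bool × List Bool) × ℕ × ℕ =>
      functionalStep p.2.1 ((Cantor.ofList p.1.1).join
        (Cantor.insertColumn (Cantor.ofList p.1.2.1) (Cantor.ofList p.1.2.2))) p.2.2 := by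
  have hs := Primrec.unpair.comp (Primrec.snd.comp
    (Primrec.snd (α := List Bool × List Bool × List Bool) (β := ℕ × ℕ)))
  refine Code.primrec_evaln.comp (((Primrec.snd.comp hs).pair
    ((Primrec.ofNat Code).comp (Primrec.fst.comp Primrec.snd))).pair
    (Primrec₂.natPair.comp (Primrec.encode.comp ?_) (Primrec.const 0)))
  exact Primrec.list_map (Primrec.list_range.comp (Primrec.fst.comp hs))
    (Cantor.primrec_join_insertColumn_ofList.comp
      ((Primrec.fst.comp Primrec.fst).pair Primrec.snd)).to₂

/-- If the operators `l m` are uniformly computable from `z`, then the set of `(z, G)` such that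
`l m` takes a value other than `L` for some `m ≥ n` and some parameter extending `τ` is
recursively enumerable. -/
theorem exists_primrecRel_of_computableLearner {z : Cantor} {l : ℕ → (ℕ → Cantor) × Cantor → ℕ}
    (hl : IsComputableLearner z l) (n L : ℕ) (τ : List Bool) :
    ∃ R : List Bool × List Bool → ℕ → Prop, PrimrecRel R ∧ ∀ G : Cantor,
      (∃ j T, R (z.initSeg j, G.initSeg j) T) ↔
        ∃ Y : Cantor, Y.initSeg τ.length = τ ∧
          ∃ m ≥ n, l m (Cantor.insertColumn G Y).toInput ≠ L := by
  obtain ⟨f, hf, hfl⟩ := hl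
  obtain ⟨F, pF, mF, eF⟩ := TuringFunctional.exists_approx (RecursiveIn.iff_nat.1 hf)
  have hval : ∀ m G Y, l m (Cantor.insertColumn G Y).toInput ∈
      turingFunctional (f m) (z.join (Cantor.insertColumn G Y)) 0 := by
    intro m G Y
    have := congrFun (hfl m) (Cantor.insertColumn G Y).toInput
    rw [turingOperator, Cantor.join_toInput] at this
    rw [this]
    simp
  -- `D a w e s` is attempt `s` of program `e` with `z` and `G` replaced by the strings `a.1` and
  -- `a.2` padded with zeros, and `Y` by `τ` followed by the string coded in `w`, also padded.
  obtain ⟨D, hD⟩ : ∃ D : List Bool × List Bool → ℕ → ℕ → ℕ → Option ℕ, D = fun a w e s =>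
    functionalStep e ((Cantor.ofList a.1).join (Cantor.insertColumn (Cantor.ofList a.2)
      (Cantor.ofList (τ ++ (Encodable.decode (α := List Bool) w.unpair.1).getD [])))) s :=
    ⟨_, rfl⟩
  have pD : Primrec fun p : ((List Bool × List Bool) × ℕ) × ℕ × ℕ =>
      D p.1.1 p.1.2 p.2.1 p.2.2 := by
    have h1 : Primrec fun p : ((List Bool × List Bool) × ℕ) × ℕ × ℕ =>
        τ ++ (Encodable.decode (α := List Bool) p.1.2.unpair.1).getD [] :=
      Primrec.list_append.comp (Primrec.const τ) (Primrec.option_getD.comp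
        (Primrec.decode.comp (Primrec.fst.comp (Primrec.unpair.comp
          (Primrec.snd.comp Primrec.fst)))) (Primrec.const []))
    rw [hD]
    exact primrec_functionalStep_ofList.comp
      (((Primrec.fst.comp (Primrec.fst.comp Primrec.fst)).pair
        ((Primrec.snd.comp (Primrec.fst.comp Primrec.fst)).pair h1)).pair Primrec.snd)
  -- The second component of `w` is the offset `m - n`, and `e` is the index `f m` as computed from
  -- `a.1`. The bound `s ≤ a.1.length` ensures, when `a.1` and `a.2` have equal length, that their
  -- padding is not read up to the first halting attempt.
  let V : List Bool × List Bool → ℕ →. Bool := fun a w =>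
    (F a.1 (n + w.unpair.2)).bind fun e =>
      (Nat.rfind fun s => Part.some (D a w e s).isSome).map fun s =>
        decide (s ≤ a.1.length) && !decide (D a w e s = some L)
  have pD' : Primrec fun p : (((List Bool × List Bool) × ℕ) × ℕ) × ℕ =>
      D p.1.1.1 p.1.1.2 p.1.2 p.2 :=
    pD.comp ((Primrec.fst.comp Primrec.fst).pair
      ((Primrec.snd.comp Primrec.fst).pair Primrec.snd))
  have h1 : Primrec fun p : (((List Bool × List Bool) × ℕ) × ℕ) × ℕ =>
      decide (p.2 ≤ p.1.1.1.1.length) :=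
    Primrec.nat_le.decide.comp Primrec.snd (Primrec.list_length.comp (Primrec.fst.comp
      (Primrec.fst.comp (Primrec.fst.comp Primrec.fst))))
  have h2 : Primrec fun p : (((List Bool × List Bool) × ℕ) × ℕ) × ℕ =>
      decide (D p.1.1.1 p.1.1.2 p.1.2 p.2 = some L) :=
    Primrec.eq.decide.comp pD' (Primrec.const (some L))
  have h3 : Partrec fun p : (((List Bool × List Bool) × ℕ) × ℕ) =>
      Nat.rfind fun s => Part.some (D p.1.1 p.1.2 p.2 s).isSome :=
    Partrec.rfind (p := fun (p : ((List Bool × List Bool) × ℕ) × ℕ) s =>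
      Part.some (D p.1.1 p.1.2 p.2 s).isSome) (Primrec.option_isSome.comp pD').to_comp.partrec
  have h4 : Partrec fun p : (List Bool × List Bool) × ℕ => F p.1.1 (n + p.2.unpair.2) :=
    pF.comp (Computable.fst.comp Computable.fst)
      (Primrec.nat_add.comp (Primrec.const n) (Primrec.snd.comp
        (Primrec.unpair.comp Primrec.snd))).to_comp
  have h5 : Primrec fun p : (((List Bool × List Bool) × ℕ) × ℕ) × ℕ =>
      decide (p.2 ≤ p.1.1.1.1.length) && !decide (D p.1.1.1 p.1.1.2 p.1.2 p.2 = some L) :=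
    Primrec.and.comp h1 (Primrec.not.comp h2)
  have pV : Partrec₂ V := h4.bind (h3.map h5.to_comp.to₂).to₂
  have hV : ∀ a w, true ∈ V a w ↔ ∃ e ∈ F a.1 (n + w.unpair.2), ∃ s ≤ a.1.length,
      (∃ v ≠ L, D a w e s = some v) ∧ ∀ s' < s, D a w e s' = none := by
    intro a w
    simp only [V, Part.mem_bind_iff, Part.mem_map_iff, mem_rfind_isSome, Bool.and_eq_true,
      decide_eq_true_eq, Bool.not_eq_true', decide_eq_false_iff_not]
    refine exists_congr fun e => and_congr_right fun _ => exists_congr fun s => ?_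
    constructor
    · rintro ⟨⟨⟨v, hv⟩, h⟩, hs, hL⟩
      exact ⟨hs, ⟨v, fun h => hL (h ▸ hv), hv⟩, h⟩
    · rintro ⟨hs, ⟨v, hL, hv⟩, h⟩
      exact ⟨⟨⟨v, hv⟩, h⟩, hs, by simpa [hv] using hL⟩
  obtain ⟨R, pR, hR⟩ := exists_primrecRel_iff pV
  have agree : ∀ (G Y : Cantor) (k : ℕ), ∀ i < k,
      (Cantor.ofList (z.initSeg k)).join (Cantor.insertColumn (Cantor.ofList (G.initSeg k)) Y) i =
        z.join (Cantor.insertColumn G Y) i := fun G Y k =>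
    Cantor.join_insertColumn_congr Y (fun _ => Cantor.ofList_apply_initSeg z)
      fun _ => Cantor.ofList_apply_initSeg G
  refine ⟨R, pR, fun G => ?_⟩
  simp only [hR, hV]
  constructor
  · rintro ⟨j, w, e, he, s, hs, ⟨v, hvL, hv⟩, hmin⟩
    simp only [Cantor.length_initSeg] at hs he
    have he' : e = f (n + w.unpair.2) := by simpa using (eF _ _).2 ⟨j, he⟩
    generalize hys : τ ++ (Encodable.decode (α := List Bool) w.unpair.1).getD [] = ys at *
    have hstep : ∀ s' ≤ s, D (z.initSeg j, G.initSeg j) w e s' =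
        functionalStep e (z.join (Cantor.insertColumn G (Cantor.ofList ys))) s' := by
      intro s' hs'
      simp only [hD, hys]
      exact functionalStep_congr e fun i hi => agree _ _ _ _ (by omega)
    refine ⟨Cantor.ofList ys, ?_, n + w.unpair.2, Nat.le_add_right _ _, ?_⟩
    · have h := Cantor.initSeg_ofList ys
      rw [← Cantor.take_initSeg (k := ys.length) _ (by simp [← hys]), h, ← hys]
      simp
    · have h1 := hval (n + w.unpair.2) G (Cantor.ofList ys)
      have h2 : v ∈ turingFunctional e (z.join (Cantor.insertColumn G (Cantor.ofList ys))) 0 :=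
        mem_turingFunctional_zero.2 ⟨s, (hstep s le_rfl).symm.trans hv,
          fun s' hs' => (hstep s' hs'.le).symm.trans (hmin s' hs')⟩
      rw [← he'] at h1
      rwa [Part.mem_unique h1 h2]
  · rintro ⟨Y, hY, m, hm, hL⟩
    obtain ⟨d, rfl⟩ := Nat.exists_eq_add_of_le hm
    obtain ⟨s, hs, hmin⟩ := mem_turingFunctional_zero.1 (hval (n + d) G Y)
    obtain ⟨k, hk⟩ := (eF (n + d) (f (n + d))).1 (by simp)
    have hYs : τ ++ (Y.initSeg (τ.length + s)).drop τ.length = Y.initSeg (τ.length + s) := by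
      conv_rhs => rw [← List.take_append_drop τ.length (Y.initSeg (τ.length + s))]
      rw [Cantor.take_initSeg _ (Nat.le_add_right _ _), hY]
    -- Length `k` suffices to compute `f (n + d)` and length `s` covers the use of the halting
    -- attempt; for the same reason `Y` may be cut at `τ.length + s`.
    refine ⟨max k s, Nat.pair (Encodable.encode ((Y.initSeg (τ.length + s)).drop τ.length)) d,
      f (n + d), ?_, s, by simp [Cantor.length_initSeg], ?_⟩
    · simp only [Nat.unpair_pair]
      refine mF _ _ _ _ ?_ hk
      rw [← Cantor.take_initSeg z (le_max_left k s)]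
      exact List.take_prefix _ _
    · have hstep : ∀ s' ≤ s, D (z.initSeg (max k s), G.initSeg (max k s))
          (Nat.pair (Encodable.encode ((Y.initSeg (τ.length + s)).drop τ.length)) d)
          (f (n + d)) s' =
          functionalStep (f (n + d)) (z.join (Cantor.insertColumn G Y)) s' := by
        intro s' hs'
        simp only [hD, Nat.unpair_pair, Encodable.encodek, Option.getD_some, hYs]
        refine functionalStep_congr _ fun i hi => (agree _ _ _ _ (by omega)).trans ?_
        exact Cantor.join_insertColumn_congr_right z G
          (fun i hi => Cantor.ofList_apply_initSeg Y hi) _ (by omega)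
      exact ⟨⟨_, hL, (hstep s le_rfl).trans hs⟩,
        fun s' hs' => (hstep s' hs'.le).trans (hmin s' hs')⟩

/-! ### Baire category for `G = H` and diagonalization for `G ≠ H` -/

/-- On the inputs with `H` in all columns with index `1`, a learner is locally constant from some
stage on, somewhere. -/
theorem IsLearner.exists_eventually_const {H : Cantor} {E : Setoid Cantor}
    (hE : ∀ x y, E x y ↔ x = y ∨ (x.column 1 = y.column 1 ∧ x.column 1 = H))
    {l : ℕ → (ℕ → Cantor) × Cantor → ℕ} (hl : IsLearner E l) :
    ∃ n L, ∃ τ : List Bool, ∀ Y : Cantor, Y.initSeg τ.length = τ →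
      ∀ m ≥ n, l m (Cantor.insertColumn H Y).toInput = L := by
  let C : ℕ × ℕ → Set Cantor := fun p =>
    {Y | ∀ m ≥ p.1, l m (Cantor.insertColumn H Y).toInput = p.2}
  have hC : ∀ p, IsClosed (C p) := by
    intro p
    have : C p = ⋂ m ≥ p.1, (fun Y => l m (Cantor.insertColumn H Y).toInput) ⁻¹' {p.2} := by
      ext Y; simp [C]
    rw [this]
    exact isClosed_biInter fun m _ => (isClosed_discrete _).preimage
      ((hl.1 m).comp (Cantor.continuous_toInput_insertColumn H))
  -- With `H` in every column 1, `x` is equivalent to `x_0`, so the learner converges; a convergent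
  -- sequence in a discrete space is eventually constant.
  have hU : ⋃ p, C p = Set.univ := by
    refine Set.eq_univ_of_forall fun Y => ?_
    obtain ⟨L, hL, -⟩ := hl.2 (Cantor.insertColumn H Y).toInput.1
      (Cantor.insertColumn H Y).toInput.2 ⟨0, (hE _ _).2 (Or.inr
        ⟨(Cantor.column_toInput_insertColumn_snd H Y).trans
          (Cantor.column_toInput_insertColumn_fst H Y 0).symm,
          Cantor.column_toInput_insertColumn_snd H Y⟩)⟩
    rw [nhds_discrete, tendsto_pure, eventually_atTop] at hL
    obtain ⟨n, hn⟩ := hL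
    exact Set.mem_iUnion.2 ⟨(n, L), hn⟩
  obtain ⟨⟨n, L⟩, Y₀, hY₀⟩ := nonempty_interior_of_iUnion_of_closed hC hU
  obtain ⟨_, ⟨X, k, rfl⟩, hX, hsub⟩ := (PiNat.isTopologicalBasis_cylinders
    (fun _ => Bool)).exists_subset_of_mem_open hY₀ isOpen_interior
  refine ⟨n, L, Cantor.initSeg X k, fun Y hY => interior_subset (hsub ?_)⟩
  rw [Cantor.length_initSeg] at hY
  exact Cantor.initSeg_eq_iff.1 hY

/-- On the inputs with `G ≠ H` in all columns with index `1`, a learner is nowhere eventually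
constant. -/
theorem IsLearner.exists_ne {H G : Cantor} {E : Setoid Cantor}
    (hE : ∀ x y, E x y ↔ x = y ∨ (x.column 1 = y.column 1 ∧ x.column 1 = H))
    {l : ℕ → (ℕ → Cantor) × Cantor → ℕ} (hl : IsLearner E l) (hG : G ≠ H) (n L : ℕ)
    (τ : List Bool) :
    ∃ Y : Cantor, Y.initSeg τ.length = τ ∧
      ∃ m ≥ n, l m (Cantor.insertColumn G Y).toInput ≠ L := by
  let B := Cantor.ofList τ
  -- Here `x` is read off from `τ` padded with zeros. Beyond `τ`, every `x_i` copies `x`, except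
  -- that `x_L` takes the complementary bits.
  let Y : Cantor := fun i =>
    if i < τ.length ∨ i % 2 = 1 then B i
    else if (i / 2).unpair.1 = L then !B (2 * (i / 2).unpair.2 + 1)
    else B (2 * (i / 2).unpair.2 + 1)
  have hodd : ∀ k, Y (2 * k + 1) = B (2 * k + 1) := fun k => if_pos (Or.inr (by omega))
  have heven : ∀ i k, τ.length ≤ 2 * Nat.pair i k → Y (2 * Nat.pair i k) =
      if i = L then !B (2 * k + 1) else B (2 * k + 1) := by
    intro i k h
    simp only [Y]
    rw [if_neg (by omega)]
    simp
  refine ⟨Y, ?_, ?_⟩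
  · refine Eq.trans (Cantor.initSeg_eq_iff.2 fun i hi => ?_) (Cantor.initSeg_ofList τ)
    exact if_pos (Or.inl hi)
  by_contra! hcon
  -- The index exceeds `L` and is so large that no bit of this entry lies inside `τ`.
  have hx : (Cantor.insertColumn G Y).toInput.2 =
      (Cantor.insertColumn G Y).toInput.1 (τ.length + L + 1) := by
    funext k
    have h1 : τ.length ≤ 2 * Nat.pair (τ.length + L + 1) k := by
      have := Nat.left_le_pair (τ.length + L + 1) k
      omega
    simp only [Cantor.toInput, Cantor.insertColumn, Cantor.position_even, Cantor.position_odd,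
      hodd, heven _ _ h1]
    rw [if_neg (show τ.length + L + 1 ≠ L by omega)]
  obtain ⟨L', hlim, hL'⟩ := hl.2 (Cantor.insertColumn G Y).toInput.1
    (Cantor.insertColumn G Y).toInput.2 ⟨τ.length + L + 1, (hE _ _).2 (Or.inl hx)⟩
  have hLL : L' = L := tendsto_nhds_unique hlim (tendsto_const_nhds.congr' <|
    (eventually_ge_atTop n).mono fun m hm => (hcon m hm).symm)
  rw [hLL, hE] at hL'
  rcases hL' with h | ⟨-, h⟩
  -- This bit lies in column 0, so `G` does not overwrite it, and its code in `Y` is beyond `τ`;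
  -- hence `x_L` has the complement of the bit of `x` there.
  · have h2 := congrFun h (Nat.pair 0 τ.length)
    have h1 : τ.length ≤ 2 * Nat.pair L (Nat.pair 0 τ.length) := by
      have := Nat.right_le_pair L (Nat.pair 0 τ.length)
      have := Nat.right_le_pair 0 τ.length
      omega
    simp [Cantor.toInput, Cantor.insertColumn, Cantor.position_even, Cantor.position_odd,
      hodd, heven _ _ h1] at h2
  · exact hG ((Cantor.column_toInput_insertColumn_snd G Y).symm.trans h)

/-- The choice of `n`, `L`, `τ` for `H` turns "a guess other than `L` occurs" into a `Σ⁰₁(z)`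
description of `G ≠ H`. -/
theorem turingReducible_of_learner {z H : Cantor} {E : Setoid Cantor}
    (hE : ∀ x y, E x y ↔ x = y ∨ (x.column 1 = y.column 1 ∧ x.column 1 = H))
    (h : LearnableWithOracle z E) : TuringReducible H.toPFun z.toPFun := by
  obtain ⟨l, hl, hc⟩ := h
  obtain ⟨n, L, τ, hconst⟩ := hl.exists_eventually_const hE
  obtain ⟨R, pR, hR⟩ := exists_primrecRel_of_computableLearner hc n L τ
  refine turingReducible_of_pi01_singleton pR fun G => ?_
  rw [hR]
  refine ⟨fun hG => hl.exists_ne hE hG n L τ, ?_⟩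
  rintro ⟨Y, hY, m, hm, hne⟩ rfl
  exact hne (hconst Y hY m hm)

/-! ### A learner for equality up to a fixed column -/

/-- The relation `≡_H`: equality, or having the column with index `1` equal to `H`, is uniformly
learnable. -/
theorem uniformlyLearnable_of_column {H : Cantor} {E : Setoid Cantor}
    (hE : ∀ x y, E x y ↔ x = y ∨ (x.column 1 = y.column 1 ∧ x.column 1 = H)) :
    UniformlyLearnable E := by
  classical
  -- `col` says that the bits seen so far are consistent with `H` in column 1. While `x` passes,
  -- `good` asks the same of the candidate; once `x` fails, it asks for equality.
  let col : (n : ℕ) → (Fin n → Bool) → Prop := fun n w => ∀ (k : Fin n) (j : ℕ),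
    (k : ℕ) = Nat.pair 1 j → w k = H j
  let good : (n : ℕ) → (Fin n → Bool) → (Fin n → Bool) → Prop := fun n w v =>
    if col n w then col n v else w = v
  -- The value `0` of `sInf` on the empty set is harmless, since the correct index eventually
  -- belongs to the set.
  let φ : (n : ℕ) → (Fin n → Fin n → Bool) × (Fin n → Bool) → ℕ := fun n p =>
    sInf {i | ∃ h : i < n, good n p.2 (p.1 ⟨i, h⟩)}
  let l : ℕ → (ℕ → Cantor) × Cantor → ℕ := fun n p =>
    φ n (fun i k => p.1 i k, fun k => p.2 k)
  have hcol : ∀ x : Cantor, x.column 1 = H → ∀ n, col n fun k => x k := by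
    rintro x rfl n k j h
    simp [Cantor.column, h]
  have hncol : ∀ x : Cantor, x.column 1 ≠ H → ∀ᶠ n in atTop, ¬col n fun k => x k := by
    intro x hx
    obtain ⟨j, hj⟩ := Function.ne_iff.1 hx
    filter_upwards [eventually_gt_atTop (Nat.pair 1 j)] with n hn h
    exact hj (h ⟨_, hn⟩ j rfl)
  have hneq : ∀ x y : Cantor, x ≠ y →
      ∀ᶠ n in atTop, (fun k : Fin n => x k) ≠ fun k : Fin n => y k := by
    intro x y hxy
    obtain ⟨j, hj⟩ := Function.ne_iff.1 hxy
    filter_upwards [eventually_gt_atTop j] with n hn h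
    exact hj (congrFun h ⟨j, hn⟩)
  have hpos : ∀ x y, E x y → ∀ᶠ n in atTop, good n (fun k => x k) fun k => y k := by
    intro x y h
    by_cases hx : x.column 1 = H
    · have hy : y.column 1 = H := by
        rcases (hE _ _).1 h with rfl | ⟨h, -⟩
        · exact hx
        · exact h ▸ hx
      refine Eventually.of_forall fun n => ?_
      simp only [good, if_pos (hcol x hx n)]
      exact hcol y hy n
    · have : x = y := ((hE _ _).1 h).resolve_right fun h => hx h.2
      subst this
      filter_upwards [hncol x hx] with n hn
      simp only [good, if_neg hn]
  have hneg : ∀ x y, ¬E x y → ∀ᶠ n in atTop, ¬good n (fun k => x k) fun k => y k := by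
    intro x y h
    rw [hE, not_or] at h
    by_cases hx : x.column 1 = H
    · have hy : y.column 1 ≠ H := fun hy => h.2 ⟨hx.trans hy.symm, hx⟩
      filter_upwards [hncol y hy] with n hn
      simpa only [good, if_pos (hcol x hx n)] using hn
    · filter_upwards [hncol x hx, hneq x y h.1] with n hn hn'
      simpa only [good, if_neg hn] using hn'
  refine ⟨l, fun n => ?_, fun xs x hx => ?_⟩
  -- The guess depends only on the first `n` bits of `x` and of the first `n` entries, a point of a
  -- discrete space.
  · refine (continuous_of_discreteTopology (f := φ n)).comp (Continuous.prodMk ?_ ?_)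
    · exact continuous_pi fun i => continuous_pi fun k =>
        (continuous_apply (k : ℕ)).comp ((continuous_apply (i : ℕ)).comp continuous_fst)
    · exact continuous_pi fun k => (continuous_apply (k : ℕ)).comp continuous_snd
  -- The limit is the least `i` with `x E x_i`: the finitely many smaller indices are all eventually
  -- rejected, and this one is eventually accepted.
  · have hL : E x (xs (sInf {i | E x (xs i)})) := Nat.sInf_mem (s := {i | E x (xs i)}) hx
    refine ⟨sInf {i | E x (xs i)}, ?_, hL⟩
    generalize hM : sInf {i | E x (xs i)} = M at hL
    have hlt : ∀ i < M, ¬E x (xs i) := fun i hi h =>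
      Nat.notMem_of_lt_sInf (hM.symm ▸ hi) h
    rw [nhds_discrete, tendsto_pure]
    have h1 : ∀ᶠ n in atTop, ∀ i ∈ Set.Iio M, ¬good n (fun k => x k) fun k => xs i k :=
      (eventually_all_finite (Set.finite_Iio M)).2 fun i hi => hneg _ _ (hlt i hi)
    filter_upwards [h1, hpos _ _ hL, eventually_gt_atTop M] with n h1 h2 h3
    refine le_antisymm (Nat.sInf_le ⟨h3, h2⟩) (le_csInf ⟨M, h3, h2⟩ ?_)
    rintro i ⟨hi, hg⟩
    by_contra! h
    exact h1 i h hg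

/-! ### The jump hierarchy and the conclusion -/

theorem Cantor.columns_congr {H K : Cantor} {A : Set ℕ}
    (h : ∀ m ∈ A, H.column m = K.column m) : H.columns A = K.columns A := by
  funext p
  by_cases hp : p.unpair.1 ∈ A
  · have := congrFun (h _ hp) p.unpair.2
    simp only [Cantor.column, Nat.pair_unpair] at this
    simp [Cantor.columns, this]
  · simp [Cantor.columns, hp]

/-- Column `n` is determined by the columns with index below `n`: recursion on `≺` gives existence,
induction gives uniqueness. -/
theorem existsUnique_isJumpHierarchy {prec : ℕ → ℕ → Prop} (hwf : WellFounded prec) :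
    ∃! H : Cantor, IsJumpHierarchy prec H := by
  classical
  let J : ℕ → Cantor := hwf.fix fun n ih => turingJump
    ((fun p => if h : prec p.unpair.1 n then ih p.unpair.1 h p.unpair.2 else false : Cantor))
  have hcolJ : ∀ n, (Cantor.seqJoin J).column n = J n := fun n => by
    funext k; simp [Cantor.column, Cantor.seqJoin]
  have hJ : IsJumpHierarchy prec (Cantor.seqJoin J) := fun n => by
    rw [hcolJ]
    refine (hwf.fix_eq _ n).trans (congrArg turingJump ?_)
    funext p
    by_cases h : prec p.unpair.1 n
    · simp only [h, dif_pos]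
      simp [Cantor.columns, h, Cantor.seqJoin, J]
    · simp [Cantor.columns, h]
  refine ⟨Cantor.seqJoin J, hJ, fun K hK => ?_⟩
  have : ∀ n, K.column n = (Cantor.seqJoin J).column n := fun n => by
    induction n using hwf.induction with
    | _ n ih =>
      exact (hK n).trans ((congrArg turingJump (Cantor.columns_congr ih)).trans (hJ n).symm)
  funext p
  have := congrFun (this p.unpair.1) p.unpair.2
  simpa only [Cantor.column, Nat.pair_unpair] using this

theorem mainTheorem11 (α : Ordinal.{0}) (prec : ℕ → ℕ → Prop)
    (hprec : IsComputablePresentation prec α) :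
    UniformlyLearnable (jumpEquiv prec) ∧
      (∃! H : Cantor, IsJumpHierarchy prec H) ∧
      ∀ H : Cantor, IsJumpHierarchy prec H →
        ∀ z : Cantor, LearnableWithOracle z (jumpEquiv prec) →
          TuringReducible H.toPFun z.toPFun := by
  obtain ⟨-, hwo, -⟩ := hprec
  have hex : ∃! H : Cantor, IsJumpHierarchy prec H := existsUnique_isJumpHierarchy hwo.wf
  -- By uniqueness, being a jump hierarchy means being equal to `H`.
  have hE : ∀ H, IsJumpHierarchy prec H → ∀ x y, jumpEquiv prec x y ↔
      x = y ∨ (x.column 1 = y.column 1 ∧ x.column 1 = H) := fun H hH x y =>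
    or_congr_right (and_congr_right fun _ =>
      ⟨fun h => hex.unique h hH, fun h => h.symm ▸ hH⟩)
  obtain ⟨H₀, hH₀, -⟩ := id hex
  exact ⟨uniformlyLearnable_of_column (hE H₀ hH₀), hex,
    fun H hH _ hz => turingReducible_of_learner (hE H hH) hz⟩
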